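/- Let $\Omega$ be a compact metric space, let $K:\Omega\times\Omega\to\mathbb R$ be continuous and symmetric, and for a finite signed Borel measure $\nu$ on $\Omega$ put $I_K(\nu)=\int_\Omega\int_\Omega K(x,y)\,d\nu(x)\,d\nu(y)$. Let $\mathbb P(\Omega)$ be the set of Borel probability measures and $\widetilde{\mathbb P}(\Omega)$ the set of finite signed Borel measures of total mass one. Let $\mu\in\mathbb P(\Omega)$ be $K$-invariant, i.e. $\int_\Omega K(x,y)\,d\mu(y)=I_K(\mu)$ for every $x\in\Omega$. Then the following conditions are equivalent: 1. $K$ is conditionally strictly positive definite: for every finite signed Borel measure $\nu$ with $\nu(\Omega)=0$ we have $I_K(\nu)\ge 0$, and $I_K(\nu)=0$ only if $\nu=0$. 2. $K$ is strictly positive definite modulo a constant: there is $C\in\mathbb R$ such that $I_{K+C}(\nu)\ge 0$ for every finite signed Borel measure $\nu$, and $I_{K+C}(\nu)=0$ only if $\nu=0$. 3. $\mu$ is the unique minimizer of $I_K$ over $\widetilde{\mathbb P}(\Omega)$. 4. $I_K$ is strictly convex on $\mathbb P(\Omega)$ (equivalently, strictly convex on $\widetilde{\mathbb P}(\Omega)$).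 Let $T_{K,\mu}\psi(x)=\int_\Omega K(x,y)\psi(y)\,d\mu(y)$ on $L^2(\Omega,\mu)$, and consider orthonormal bases $\{\phi_j\}_{j=1}^{\dim L^2(\Omega,\mu)}$ of $L^2(\Omega,\mu)$ with $T_{K,\mu}\phi_j=\lambda_j\phi_j$ and $\phi_1$ constant. If in addition $\operatorname{supp}(\mu)=\Omega$, then each of the conditions 1–4 implies that such bases exist and that every such basis satisfies (after the choice of continuous representatives, which exist): 5. the functions $\phi_j$ are continuous, $\phi_1$ is constant, $\lambda_j>0$ for all $j\ge 2$, and $$K(x,y)=\sum_{j=1}^{\dim L^2(\Omega,\mu)}\lambda_j\phi_j(x)\phi_j(y)\qquad\text{for all }x,y\in\Omega,$$ where the series converges absolutely and uniformly on $\Omega\times\Omega$. Moreover (whether or not $\mu$ has full support), if condition 5 holds for some orthonormal basis $\{\phi_j\}$ of $L^2(\Omega,\mu)$ consisting of eigenfunctions of $T_{K,\mu}$ with eigenvalues $\lambda_j$, and the linear span of $\{\phi_j\}$ is dense in $C(\Omega)$ with the supremum norm, then conditions 1–4 hold. -/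

import Mathlib

open MeasureTheory Filter Topology
open scoped ENNReal

noncomputable section

namespace EnergyKernel

section Algebraic

variable {Ω : Type*} [TopologicalSpace Ω] [MeasurableSpace Ω]

/-- A kernel is a continuous symmetric real function on `Ω × Ω`. -/
structure IsKernel (K : Ω → Ω → ℝ) : Prop where
  continuous : Continuous (fun p : Ω × Ω => K p.1 p.2)
  symm : ∀ x y, K x y = K y x

/-- The potential `U_K^ν (x) = ∫ K(x, y) dν(y)` of a finite signed measure. -/
def potential (K : Ω → Ω → ℝ) (ν : SignedMeasure Ω) (x : Ω) : ℝ :=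
  ∫ᵛ y, K x y ∂<•ν

/-- The energy `I_K(ν) = ∫∫ K(x, y) dν(x) dν(y)` of a finite signed measure. -/
def energy (K : Ω → Ω → ℝ) (ν : SignedMeasure Ω) : ℝ :=
  ∫ᵛ y, (∫ᵛ x, K x y ∂<•ν) ∂<•ν

/-- The signed measures of total mass one. -/
def massOne (Ω : Type*) [MeasurableSpace Ω] : Set (SignedMeasure Ω) :=
  {ν | ν Set.univ = 1}

/-- The probability measures, as a subset of the space of signed measures. -/
def probabilities (Ω : Type*) [MeasurableSpace Ω] : Set (SignedMeasure Ω) :=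
  {ν | 0 ≤ ν ∧ ν Set.univ = 1}

/-- Strict positive definiteness, tested on all finite signed measures. -/
def StrictlyPositiveDefinite (K : Ω → Ω → ℝ) : Prop :=
  (∀ ν : SignedMeasure Ω, 0 ≤ energy K ν) ∧
    ∀ ν : SignedMeasure Ω, energy K ν = 0 → ν = 0

/-- Conditional strict positive definiteness, tested on signed measures of total mass zero. -/
def ConditionallyStrictlyPositiveDefinite (K : Ω → Ω → ℝ) : Prop :=
  (∀ ν : SignedMeasure Ω, ν Set.univ = 0 → 0 ≤ energy K ν) ∧
    ∀ ν : SignedMeasure Ω, ν Set.univ = 0 → energy K ν = 0 → ν = 0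

/-- Strict positive definiteness up to an additive constant. -/
def StrictlyPositiveDefiniteModConst (K : Ω → Ω → ℝ) : Prop :=
  ∃ C : ℝ, StrictlyPositiveDefinite (fun x y => K x y + C)

/-- `ν₀` is the unique minimizer of `F` over the set `S`. -/
def IsUniqueMinimizer (F : SignedMeasure Ω → ℝ) (S : Set (SignedMeasure Ω))
    (ν₀ : SignedMeasure Ω) : Prop :=
  ν₀ ∈ S ∧ IsMinOn F S ν₀ ∧ ∀ ν ∈ S, IsMinOn F S ν → ν = ν₀

/-- A probability measure is `K`-invariant if its potential is the constant `I_K(μ)` on all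
of `Ω`. -/
def IsInvariant (K : Ω → Ω → ℝ) (μ : Measure Ω) [IsProbabilityMeasure μ] : Prop :=
  ∀ x, potential K μ.toSignedMeasure x = energy K μ.toSignedMeasure

end Algebraic

section HilbertSchmidt

variable {Ω : Type*} [MeasurableSpace Ω]

/-- The Hilbert–Schmidt operator `(T_{K,μ} ψ)(x) = ∫ K(x, y) ψ(y) dμ(y)`. -/
def hsOperator (K : Ω → Ω → ℝ) (μ : Measure Ω) (ψ : Ω → ℝ) (x : Ω) : ℝ :=
  ∫ y, K x y * ψ y ∂μ

/-- The dimension of `L²(Ω, μ)`, with value `⊤` if the space is infinite dimensional. -/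
def l2Dim (μ : Measure Ω) : ℕ∞ :=
  Cardinal.toENat (Module.rank ℝ (Lp ℝ 2 μ))

/-- The indices `j = 1, …, dim L²(Ω, μ)`, shifted so as to start from `0`. -/
abbrev L2Index (μ : Measure Ω) : Type :=
  {j : ℕ // (j : ℕ∞) < l2Dim μ}

/-- `e` is an orthonormal basis (complete orthonormal system) of `L²(Ω, μ)` with
`T_{K,μ} e_j = lam_j e_j` in `L²(Ω, μ)`. -/
structure IsEigenbasis (K : Ω → Ω → ℝ) (μ : Measure Ω)
    (lam : L2Index μ → ℝ) (e : L2Index μ → Lp ℝ 2 μ) : Prop where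
  orthonormal : Orthonormal ℝ e
  complete : (Submodule.span ℝ (Set.range e)).topologicalClosure = ⊤
  eigen : ∀ j, hsOperator K μ (e j) =ᵐ[μ] fun x => lam j * e j x

variable [MetricSpace Ω] [CompactSpace Ω] [BorelSpace Ω]

/-- The strict Mercer expansion of `K`: the continuous functions `φ_j` form an orthonormal basis of
`L²(Ω, μ)` of eigenfunctions of `T_{K,μ}`, with the first one constant and all eigenvalues after
the first one positive, and `K(x, y) = ∑ lam_j φ_j(x) φ_j(y)` with absolute and uniform
convergence. The first index is `0` here. -/
structure IsStrictMercerExpansion (K : Ω → Ω → ℝ) (μ : Measure Ω) [IsFiniteMeasure μ]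
    (lam : L2Index μ → ℝ) (φ : L2Index μ → C(Ω, ℝ)) : Prop where
  eigenbasis : IsEigenbasis K μ lam (fun j => ContinuousMap.toLp 2 μ ℝ (φ j))
  const_first : ∀ j : L2Index μ, j.1 = 0 → ∃ c : ℝ, ∀ x, φ j x = c
  pos : ∀ j : L2Index μ, 1 ≤ j.1 → 0 < lam j
  summable_abs : ∀ x y, Summable (fun j : L2Index μ => |lam j * φ j x * φ j y|)
  uniform : TendstoUniformly
    (fun (n : ℕ) (p : Ω × Ω) => ∑ j ∈ Finset.range n,
      if h : (j : ℕ∞) < l2Dim μ then lam ⟨j, h⟩ * φ ⟨j, h⟩ p.1 * φ ⟨j, h⟩ p.2 else 0)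
    (fun p => K p.1 p.2) atTop

end HilbertSchmidt

end EnergyKernel

end

/-! Invariance says that the potential of `μ` is constant, so the mutual energy of `μ` with any `ν`
is `I_K(μ) ν(Ω)` (`mutualEnergy_of_isInvariant`). Splitting `ν = ν(Ω) μ + ν₀` with `ν₀(Ω) = 0`
therefore gives `I_{K+C}(ν) = (I_K(μ) + C) ν(Ω)² + I_K(ν₀)` (`energy_add_const_of_isInvariant`).
Conditions 1, 2 and 3 all become statements about `I_K(ν₀)`. For convexity, the defect of `I_K` at
`aν + bσ` is `ab I_K(ν - σ)`, and differences of probability measures span the measures of mass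
zero.

For the expansion, put `L = K - I_K(μ)`. Under condition 1 it is positive semidefinite on all signed
measures; it has the same eigenfunctions as `K`, and only the eigenvalue of the constant changes, to
zero. Mercer's theorem is proved for `L`: a Bessel inequality on the diagonal
(`sum_mul_sq_le_diag`), pointwise identification of the sum using full support (`hasSum_mul_mul`),
and Dini's theorem (`tendstoUniformly_sum_mul_mul`). Adding back the constant, which is exactly the
first term of the series, gives the expansion of `K`. Eigenbases exist by the spectral theorem for
compact symmetric operators, the constants being eigenvectors by invariance.

Conversely, the expansion gives `I_K(ν) = ∑ λ_j (∫ φ_j dν)²`. Mass zero removes the constant term,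
so this is nonnegative; if it vanishes, `ν` annihilates a dense subspace of `C(Ω)`. -/

noncomputable section

set_option linter.unusedSectionVars false

namespace EnergyKernel

/-! ### Integration of continuous functions against signed measures -/

section SignedIntegral

variable {Ω : Type*} [MeasurableSpace Ω]

instance isFiniteMeasure_variation (ν : SignedMeasure Ω) : IsFiniteMeasure ν.variation := by
  rw [← SignedMeasure.totalVariation_eq_variation]
  infer_instance

theorem signedMeasure_eq_posPart_sub_negPart (ν : SignedMeasure Ω) :
    ν = ν.toJordanDecomposition.posPart.toSignedMeasure -
      ν.toJordanDecomposition.negPart.toSignedMeasure :=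
  (SignedMeasure.toSignedMeasure_toJordanDecomposition ν).symm

theorem signedMeasure_sub_eq (ν σ : SignedMeasure Ω) : ν - σ = ν + (-1 : ℝ) • σ := by
  ext i hi
  simp [sub_eq_add_neg]

variable [TopologicalSpace Ω] [CompactSpace Ω] [BorelSpace Ω]

theorem integrable_of_continuous {f : Ω → ℝ} (hf : Continuous f) (m : Measure Ω)
    [IsFiniteMeasure m] : Integrable f m :=
  hf.integrable_of_hasCompactSupport (HasCompactSupport.of_compactSpace f)

theorem signedIntegral_eq_sub {f : Ω → ℝ} (hf : Continuous f) (ν : SignedMeasure Ω) :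
    ∫ᵛ x, f x ∂<•ν = ∫ x, f x ∂ν.toJordanDecomposition.posPart -
      ∫ x, f x ∂ν.toJordanDecomposition.negPart := by
  conv_lhs => rw [signedMeasure_eq_posPart_sub_negPart ν]
  rw [VectorMeasure.integral_sub_vectorMeasure (integrable_of_continuous hf _)
    (integrable_of_continuous hf _)]
  simp

theorem signedIntegral_add {f g : Ω → ℝ} (hf : Continuous f) (hg : Continuous g)
    (ν : SignedMeasure Ω) :
    ∫ᵛ x, (f x + g x) ∂<•ν = ∫ᵛ x, f x ∂<•ν + ∫ᵛ x, g x ∂<•ν :=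
  VectorMeasure.integral_fun_add (integrable_of_continuous hf _) (integrable_of_continuous hg _)

theorem signedIntegral_const_mul (c : ℝ) (f : Ω → ℝ) (ν : SignedMeasure Ω) :
    ∫ᵛ x, c * f x ∂<•ν = c * ∫ᵛ x, f x ∂<•ν :=
  VectorMeasure.integral_fun_smul ν _ c f

theorem signedIntegral_const (c : ℝ) (ν : SignedMeasure Ω) :
    ∫ᵛ _, c ∂<•ν = c * ν Set.univ := by
  rw [VectorMeasure.integral_const]
  simp [mul_comm]

theorem signedIntegral_add_measure {f : Ω → ℝ} (hf : Continuous f) (ν σ : SignedMeasure Ω) :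
    ∫ᵛ x, f x ∂<•(ν + σ) = ∫ᵛ x, f x ∂<•ν + ∫ᵛ x, f x ∂<•σ :=
  VectorMeasure.integral_add_vectorMeasure (integrable_of_continuous hf _)
    (integrable_of_continuous hf _)

/-- A signed measure which annihilates all continuous functions vanishes. -/
theorem eq_zero_of_forall_signedIntegral_eq_zero {Ω : Type*} [MeasurableSpace Ω] [MetricSpace Ω]
    [CompactSpace Ω] [BorelSpace Ω] {ν : SignedMeasure Ω}
    (h : ∀ f : C(Ω, ℝ), ∫ᵛ x, f x ∂<•ν = 0) : ν = 0 := by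
  rw [signedMeasure_eq_posPart_sub_negPart ν, sub_eq_zero]
  apply Measure.toSignedMeasure_congr
  apply ext_of_forall_integral_eq_of_IsFiniteMeasure
  intro f
  have := h f.toContinuousMap
  rw [signedIntegral_eq_sub f.toContinuousMap.continuous] at this
  exact sub_eq_zero.1 this

end SignedIntegral

/-! ### The energy as a quadratic form -/

section MutualEnergy

variable {Ω : Type*} [MeasurableSpace Ω] [MetricSpace Ω] [CompactSpace Ω] [BorelSpace Ω]
  {K : Ω → Ω → ℝ}

/-- The mutual energy `∫∫ K(x, y) dν(x) dσ(y)` of two signed measures. -/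
def mutualEnergy (K : Ω → Ω → ℝ) (ν σ : SignedMeasure Ω) : ℝ :=
  ∫ᵛ y, (∫ᵛ x, K x y ∂<•ν) ∂<•σ

theorem mutualEnergy_self (K : Ω → Ω → ℝ) (ν : SignedMeasure Ω) :
    mutualEnergy K ν ν = energy K ν := rfl

theorem IsKernel.continuous_left (hK : IsKernel K) (y : Ω) : Continuous fun x => K x y :=
  hK.continuous.comp (by fun_prop : Continuous fun x => (x, y))

theorem IsKernel.continuous_right (hK : IsKernel K) (x : Ω) : Continuous fun y => K x y :=
  hK.continuous.comp (by fun_prop : Continuous fun y => (x, y))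

theorem continuous_integral_left (hK : Continuous fun p : Ω × Ω => K p.1 p.2) (m : Measure Ω)
    [IsFiniteMeasure m] : Continuous fun y => ∫ x, K x y ∂m := by
  obtain ⟨C, hC⟩ := isCompact_univ.exists_bound_of_continuousOn hK.continuousOn
  refine continuous_of_dominated (bound := fun _ => C)
    (fun y => (hK.comp (by fun_prop : Continuous fun x => (x, y))).aestronglyMeasurable)
    (fun y => .of_forall fun x => hC (x, y) trivial) (integrable_const C)
    (.of_forall fun x => hK.comp (by fun_prop : Continuous fun y => (x, y)))

theorem IsKernel.continuous_signedIntegral (hK : IsKernel K) (ν : SignedMeasure Ω) :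
    Continuous fun y => ∫ᵛ x, K x y ∂<•ν := by
  simp_rw [fun y => signedIntegral_eq_sub (hK.continuous_left y) ν]
  exact (continuous_integral_left hK.continuous _).sub (continuous_integral_left hK.continuous _)

theorem IsKernel.potential_eq (hK : IsKernel K) (ν : SignedMeasure Ω) (y : Ω) :
    potential K ν y = ∫ᵛ x, K x y ∂<•ν := by
  simp_rw [potential, hK.symm y]

theorem IsKernel.mutualEnergy_eq (hK : IsKernel K) (ν σ : SignedMeasure Ω) :
    mutualEnergy K ν σ = ∫ᵛ y, potential K ν y ∂<•σ := by
  simp_rw [hK.potential_eq, mutualEnergy]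

theorem IsKernel.continuous_potential (hK : IsKernel K) (ν : SignedMeasure Ω) :
    Continuous (potential K ν) := by
  simp_rw [funext (hK.potential_eq ν)]
  exact hK.continuous_signedIntegral ν

theorem IsKernel.mutualEnergy_add_left (hK : IsKernel K) (ν ν' σ : SignedMeasure Ω) :
    mutualEnergy K (ν + ν') σ = mutualEnergy K ν σ + mutualEnergy K ν' σ := by
  simp_rw [mutualEnergy, fun y => signedIntegral_add_measure (hK.continuous_left y) ν ν']
  exact signedIntegral_add (hK.continuous_signedIntegral _) (hK.continuous_signedIntegral _) _

theorem IsKernel.mutualEnergy_add_right (hK : IsKernel K) (ν σ σ' : SignedMeasure Ω) :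
    mutualEnergy K ν (σ + σ') = mutualEnergy K ν σ + mutualEnergy K ν σ' :=
  signedIntegral_add_measure (hK.continuous_signedIntegral _) _ _

theorem mutualEnergy_smul_right (c : ℝ) (ν σ : SignedMeasure Ω) :
    mutualEnergy K ν (c • σ) = c * mutualEnergy K ν σ :=
  VectorMeasure.integral_smul_vectorMeasure _ c

theorem mutualEnergy_smul_left (c : ℝ) (ν σ : SignedMeasure Ω) :
    mutualEnergy K (c • ν) σ = c * mutualEnergy K ν σ := by
  simp_rw [mutualEnergy, VectorMeasure.integral_smul_vectorMeasure]
  exact VectorMeasure.integral_fun_smul σ _ c _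

theorem IsKernel.mutualEnergy_toSignedMeasure_comm (hK : IsKernel K) (m n : Measure Ω)
    [IsFiniteMeasure m] [IsFiniteMeasure n] :
    mutualEnergy K m.toSignedMeasure n.toSignedMeasure =
      mutualEnergy K n.toSignedMeasure m.toSignedMeasure := by
  simp_rw [mutualEnergy, VectorMeasure.integral_toSignedMeasure]
  rw [integral_integral_swap]
  · simp_rw [hK.symm]
  · exact (hK.continuous.comp continuous_swap).integrable_of_hasCompactSupport
      (HasCompactSupport.of_compactSpace _)

/-- Bilinearity and the Jordan decompositions reduce this to positive measures, where it is Fubini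
together with the symmetry of `K`. -/
theorem IsKernel.mutualEnergy_comm (hK : IsKernel K) (ν σ : SignedMeasure Ω) :
    mutualEnergy K ν σ = mutualEnergy K σ ν := by
  rw [signedMeasure_eq_posPart_sub_negPart ν, signedMeasure_eq_posPart_sub_negPart σ]
  simp only [signedMeasure_sub_eq, hK.mutualEnergy_add_left, hK.mutualEnergy_add_right, mutualEnergy_smul_left,
    mutualEnergy_smul_right]
  simp only [hK.mutualEnergy_toSignedMeasure_comm σ.toJordanDecomposition.posPart,
    hK.mutualEnergy_toSignedMeasure_comm σ.toJordanDecomposition.negPart]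
  ring

theorem IsKernel.energy_add (hK : IsKernel K) (ν σ : SignedMeasure Ω) :
    energy K (ν + σ) = energy K ν + 2 * mutualEnergy K ν σ + energy K σ := by
  rw [← mutualEnergy_self, hK.mutualEnergy_add_left, hK.mutualEnergy_add_right,
    hK.mutualEnergy_add_right, hK.mutualEnergy_comm σ ν, mutualEnergy_self, mutualEnergy_self]
  ring

theorem energy_smul (c : ℝ) (ν : SignedMeasure Ω) : energy K (c • ν) = c ^ 2 * energy K ν := by
  rw [← mutualEnergy_self, mutualEnergy_smul_left, mutualEnergy_smul_right, mutualEnergy_self]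
  ring

theorem IsKernel.energy_sub (hK : IsKernel K) (ν σ : SignedMeasure Ω) :
    energy K (ν - σ) = energy K ν - 2 * mutualEnergy K ν σ + energy K σ := by
  rw [signedMeasure_sub_eq, hK.energy_add,
    mutualEnergy_smul_right, energy_smul]
  ring

theorem IsKernel.add_const (hK : IsKernel K) (C : ℝ) : IsKernel fun x y => K x y + C :=
  ⟨hK.continuous.add continuous_const, fun x y => by rw [hK.symm]⟩

theorem IsKernel.energy_add_const (hK : IsKernel K) (C : ℝ) (ν : SignedMeasure Ω) :
    energy (fun x y => K x y + C) ν = energy K ν + C * ν Set.univ ^ 2 := by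
  have h : ∀ y, ∫ᵛ x, (K x y + C) ∂<•ν = ∫ᵛ x, K x y ∂<•ν + C * ν Set.univ := fun y => by
    rw [signedIntegral_add (hK.continuous_left y) continuous_const, signedIntegral_const]
  simp only [energy, h]
  rw [signedIntegral_add (hK.continuous_signedIntegral ν) continuous_const, signedIntegral_const]
  ring

theorem mutualEnergy_of_isInvariant (hK : IsKernel K) {μ : Measure Ω} [IsProbabilityMeasure μ]
    (hμ : IsInvariant K μ) (ν : SignedMeasure Ω) :
    mutualEnergy K μ.toSignedMeasure ν = energy K μ.toSignedMeasure * ν Set.univ := by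
  rw [hK.mutualEnergy_eq, funext hμ]
  exact signedIntegral_const _ _

end MutualEnergy

/-! ### Equivalence of the positivity, minimality and convexity conditions -/

section Equivalences

variable {Ω : Type*} [MeasurableSpace Ω] [MetricSpace Ω] [CompactSpace Ω] [BorelSpace Ω]
  {K : Ω → Ω → ℝ} {μ : Measure Ω} [IsProbabilityMeasure μ]

theorem energy_zero (K : Ω → Ω → ℝ) : energy K 0 = 0 := by
  simp [energy]

theorem conditionallyStrictlyPositiveDefinite_iff :
    ConditionallyStrictlyPositiveDefinite K ↔
      ∀ ν : SignedMeasure Ω, ν Set.univ = 0 → ν ≠ 0 → 0 < energy K ν := by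
  constructor
  · rintro ⟨h, h'⟩ ν hν hne
    exact (h ν hν).lt_of_ne fun he => hne (h' ν hν he.symm)
  · intro h
    refine ⟨fun ν hν => ?_, fun ν hν he => ?_⟩
    · by_cases hne : ν = 0
      · rw [hne, energy_zero]
      · exact (h ν hν hne).le
    · by_contra hne
      exact (h ν hν hne).ne' he

theorem toSignedMeasure_univ (μ : Measure Ω) [IsProbabilityMeasure μ] :
    μ.toSignedMeasure Set.univ = 1 := by
  simp

theorem probabilities_subset_massOne : probabilities Ω ⊆ massOne Ω := fun _ h => h.2

theorem convex_massOne : Convex ℝ (massOne Ω) := by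
  intro ν hν σ hσ a b _ _ hab
  simp only [massOne, Set.mem_ofPred_eq] at *
  simp [hν, hσ, hab]

theorem convex_probabilities : Convex ℝ (probabilities Ω) := by
  intro ν hν σ hσ a b ha hb hab
  refine ⟨fun i hi => ?_, convex_massOne hν.2 hσ.2 ha hb hab⟩
  have h1 := hν.1 i hi
  have h2 := hσ.1 i hi
  simp only [FunLike.coe_zero, Pi.zero_apply] at h1 h2
  simp only [FunLike.coe_zero, Pi.zero_apply, FunLike.coe_add, Pi.add_apply,
    FunLike.coe_smul, Pi.smul_apply, smul_eq_mul]
  positivity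

theorem energy_eq_add_of_isInvariant (hK : IsKernel K) (hμ : IsInvariant K μ)
    (ν : SignedMeasure Ω) :
    energy K (μ.toSignedMeasure + ν) =
      energy K μ.toSignedMeasure * (1 + 2 * ν Set.univ) + energy K ν := by
  rw [hK.energy_add, mutualEnergy_of_isInvariant hK hμ]
  ring

/-- On mass one, `I_K(ν) = I_K(μ) + I_K(ν - μ)`, and `ν - μ` ranges over all signed measures of mass
zero. -/
theorem isUniqueMinimizer_iff (hK : IsKernel K) (hμ : IsInvariant K μ) :
    IsUniqueMinimizer (energy K) (massOne Ω) μ.toSignedMeasure ↔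
      ConditionallyStrictlyPositiveDefinite K := by
  have key : ∀ ν ∈ massOne Ω, energy K ν =
      energy K μ.toSignedMeasure + energy K (ν - μ.toSignedMeasure) := fun ν hν => by
    have h0 : (ν - μ.toSignedMeasure) Set.univ = 0 := by
      rw [_root_.sub_apply, toSignedMeasure_univ, show ν Set.univ = 1 from hν, sub_self]
    have := energy_eq_add_of_isInvariant hK hμ (ν - μ.toSignedMeasure)
    rw [h0, add_sub_cancel] at this
    linarith
  constructor
  · rintro ⟨hmem, hmin, huniq⟩
    have hadd : ∀ ν : SignedMeasure Ω, ν Set.univ = 0 → μ.toSignedMeasure + ν ∈ massOne Ω :=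
      fun ν hν => by
        simp only [massOne, Set.mem_ofPred_eq]
        rw [_root_.add_apply, toSignedMeasure_univ, hν, add_zero]
    refine ⟨fun ν hν => ?_, fun ν hν he => ?_⟩
    · have h1 := hmin (hadd ν hν)
      have h2 := key _ (hadd ν hν)
      simp only [Set.mem_ofPred_eq] at h1
      rw [add_sub_cancel_left] at h2
      linarith
    · have h2 := key _ (hadd ν hν)
      rw [add_sub_cancel_left, he, add_zero] at h2
      have := huniq _ (hadd ν hν) fun σ hσ => by
        have := hmin hσ
        simp only [Set.mem_ofPred_eq] at this ⊢
        rwa [h2]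
      simpa using this
  · rintro ⟨hnn, hz⟩
    have h0 : ∀ ν ∈ massOne Ω, (ν - μ.toSignedMeasure) Set.univ = 0 := fun ν hν => by
      rw [_root_.sub_apply, toSignedMeasure_univ, show ν Set.univ = 1 from hν, sub_self]
    refine ⟨toSignedMeasure_univ μ, fun ν hν => ?_, fun ν hν hmin => ?_⟩
    · have := hnn _ (h0 ν hν)
      have h2 := key ν hν
      simp only [Set.mem_ofPred_eq]
      linarith
    · have h1 := hmin (toSignedMeasure_univ μ : μ.toSignedMeasure ∈ massOne Ω)
      simp only [Set.mem_ofPred_eq] at h1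
      have h2 := key ν hν
      have h3 := hnn _ (h0 ν hν)
      exact sub_eq_zero.1 (hz _ (h0 ν hν) (by linarith))

/-- The energy of the kernel with an added constant, in terms of the part of a signed measure of
total mass zero. -/
theorem energy_add_const_of_isInvariant (hK : IsKernel K) (hμ : IsInvariant K μ) (C : ℝ)
    (ν : SignedMeasure Ω) :
    energy (fun x y => K x y + C) ν =
      (energy K μ.toSignedMeasure + C) * ν Set.univ ^ 2 +
        energy K (ν - (ν Set.univ) • μ.toSignedMeasure) := by
  rw [hK.energy_add_const, hK.energy_sub, mutualEnergy_smul_right, energy_smul,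
    hK.mutualEnergy_comm, mutualEnergy_of_isInvariant hK hμ]
  ring

theorem sub_smul_toSignedMeasure_univ (μ : Measure Ω) [IsProbabilityMeasure μ]
    (ν : SignedMeasure Ω) : (ν - (ν Set.univ) • μ.toSignedMeasure) Set.univ = 0 := by
  rw [_root_.sub_apply, _root_.smul_apply, toSignedMeasure_univ, smul_eq_mul, mul_one, sub_self]

/-- The choice `C = -I_K(μ)` cancels the mass term. This supplies the positive semidefinite kernel
to which Mercer's theorem is applied. -/
theorem energy_sub_const_nonneg (hK : IsKernel K) (hμ : IsInvariant K μ)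
    (h : ConditionallyStrictlyPositiveDefinite K) (ν : SignedMeasure Ω) :
    0 ≤ energy (fun x y => K x y + -energy K μ.toSignedMeasure) ν := by
  rw [energy_add_const_of_isInvariant hK hμ]
  simpa using h.1 _ (sub_smul_toSignedMeasure_univ μ ν)

theorem strictlyPositiveDefiniteModConst_iff (hK : IsKernel K) (hμ : IsInvariant K μ) :
    StrictlyPositiveDefiniteModConst K ↔ ConditionallyStrictlyPositiveDefinite K := by
  constructor
  · rintro ⟨C, hnn, hz⟩
    have key : ∀ ν : SignedMeasure Ω, ν Set.univ = 0 →
        energy (fun x y => K x y + C) ν = energy K ν := fun ν hν => by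
      rw [hK.energy_add_const, hν]; ring
    exact ⟨fun ν hν => key ν hν ▸ hnn ν, fun ν hν he => hz ν (by rw [key ν hν, he])⟩
  · rintro ⟨hnn, hz⟩
    -- This constant makes the coefficient of `ν(Ω)²` equal to one; any constant above `-I_K(μ)`
    -- would do.
    refine ⟨1 - energy K μ.toSignedMeasure, fun ν => ?_, fun ν he => ?_⟩
    · rw [energy_add_const_of_isInvariant hK hμ, add_sub_cancel, one_mul]
      have := hnn _ (sub_smul_toSignedMeasure_univ μ ν)
      positivity
    · rw [energy_add_const_of_isInvariant hK hμ, add_sub_cancel, one_mul] at he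
      have h1 := hnn _ (sub_smul_toSignedMeasure_univ μ ν)
      have h2 := sq_nonneg (ν Set.univ)
      have h3 : ν Set.univ = 0 := pow_eq_zero_iff (two_ne_zero) |>.1 (by linarith)
      exact hz ν h3 (by simpa [h3] using he)

/-- The convexity defect of a quadratic form is the form at the difference, so strict convexity is
positivity on differences. -/
theorem IsKernel.energy_convexComb (hK : IsKernel K) (ν σ : SignedMeasure Ω) {a b : ℝ}
    (hab : a + b = 1) :
    energy K (a • ν + b • σ) = a * energy K ν + b * energy K σ - a * b * energy K (ν - σ) := by
  rw [hK.energy_add, hK.energy_sub, energy_smul, energy_smul, mutualEnergy_smul_left,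
    mutualEnergy_smul_right]
  obtain rfl : b = 1 - a := by linarith
  ring

theorem strictConvexOn_massOne (hK : IsKernel K) (h : ConditionallyStrictlyPositiveDefinite K) :
    StrictConvexOn ℝ (massOne Ω) (energy K) := by
  rw [conditionallyStrictlyPositiveDefinite_iff] at h
  refine ⟨convex_massOne, fun ν hν σ hσ hne a b ha hb hab => ?_⟩
  have h0 := h (ν - σ) (by
    rw [_root_.sub_apply, show ν Set.univ = 1 from hν, show σ Set.univ = 1 from hσ, sub_self])
    (sub_ne_zero.2 hne)
  rw [hK.energy_convexComb ν σ hab, smul_eq_mul, smul_eq_mul]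
  have := mul_pos (mul_pos ha hb) h0
  linarith

/-- Every signed measure of total mass zero is a multiple of a difference of two probability
measures. -/
theorem exists_eq_smul_sub_of_univ_eq_zero {ν : SignedMeasure Ω} (hν : ν Set.univ = 0)
    (hne : ν ≠ 0) : ∃ c : ℝ, ∃ σ ∈ probabilities Ω, ∃ τ ∈ probabilities Ω,
      ν = c • (σ - τ) := by
  set p := ν.toJordanDecomposition.posPart
  set n := ν.toJordanDecomposition.negPart
  have hpn : ν = p.toSignedMeasure - n.toSignedMeasure := signedMeasure_eq_posPart_sub_negPart ν
  have hmass : p.real Set.univ = n.real Set.univ := by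
    have := ν.apply_eq_posPart_real_sub_negPart_real MeasurableSet.univ
    rw [hν] at this
    exact (sub_eq_zero.1 this.symm)
  have hc : p.real Set.univ ≠ 0 := by
    intro h0
    have hp : p = 0 := by
      rwa [measureReal_eq_zero_iff, Measure.measure_univ_eq_zero] at h0
    have hn : n = 0 := by
      rwa [hmass, measureReal_eq_zero_iff, Measure.measure_univ_eq_zero] at h0
    apply hne
    rw [hpn]
    simp [hp, hn]
  have hprob : ∀ (m : Measure Ω) [IsFiniteMeasure m], m.real Set.univ = p.real Set.univ →
      (p.real Set.univ)⁻¹ • m.toSignedMeasure ∈ probabilities Ω := fun m _ hm => by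
    refine ⟨fun i hi => ?_, ?_⟩
    · have := Measure.zero_le_toSignedMeasure m i hi
      simp only [FunLike.coe_zero, Pi.zero_apply] at this ⊢
      rw [_root_.smul_apply, smul_eq_mul]
      exact mul_nonneg (inv_nonneg.2 measureReal_nonneg) this
    · rw [_root_.smul_apply, Measure.toSignedMeasure_apply_measurable MeasurableSet.univ, hm,
        smul_eq_mul, inv_mul_cancel₀ hc]
  -- The scalar is the common mass of the two Jordan parts, each normalized by it.
  refine ⟨p.real Set.univ, _, hprob p rfl, _, hprob n hmass.symm, ?_⟩
  conv_lhs => rw [hpn]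
  ext i hi
  simp only [_root_.sub_apply, _root_.smul_apply, smul_eq_mul]
  field_simp

theorem conditionallyStrictlyPositiveDefinite_of_strictConvexOn (hK : IsKernel K)
    (h : StrictConvexOn ℝ (probabilities Ω) (energy K)) :
    ConditionallyStrictlyPositiveDefinite K := by
  rw [conditionallyStrictlyPositiveDefinite_iff]
  intro ν hν hne
  obtain ⟨c, σ, hσ, τ, hτ, rfl⟩ := exists_eq_smul_sub_of_univ_eq_zero hν hne
  have hc : c ≠ 0 := fun h0 => hne (by rw [h0, zero_smul])
  have hστ : σ ≠ τ := fun h0 => hne (by rw [h0, sub_self, smul_zero])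
  have h1 := h.2 hσ hτ hστ one_half_pos one_half_pos (add_halves 1)
  rw [hK.energy_convexComb σ τ (add_halves 1), smul_eq_mul, smul_eq_mul] at h1
  rw [energy_smul]
  have : 0 < c ^ 2 := by positivity
  exact mul_pos this (by linarith)

theorem tfae_conditionallyStrictlyPositiveDefinite (hK : IsKernel K) (hμ : IsInvariant K μ) :
    List.TFAE
      [ConditionallyStrictlyPositiveDefinite K,
       StrictlyPositiveDefiniteModConst K,
       IsUniqueMinimizer (energy K) (massOne Ω) μ.toSignedMeasure,
       StrictConvexOn ℝ (probabilities Ω) (energy K),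
       StrictConvexOn ℝ (massOne Ω) (energy K)] := by
  tfae_have 1 ↔ 2 := (strictlyPositiveDefiniteModConst_iff hK hμ).symm
  tfae_have 1 ↔ 3 := (isUniqueMinimizer_iff hK hμ).symm
  tfae_have 1 → 5 := strictConvexOn_massOne hK
  tfae_have 5 → 4 := fun h => h.subset probabilities_subset_massOne convex_probabilities
  tfae_have 4 → 1 := conditionallyStrictlyPositiveDefinite_of_strictConvexOn hK
  tfae_finish

end Equivalences

/-! ### Energy of a uniformly convergent kernel series -/

section UniformLimits

variable {Ω : Type*} [MeasurableSpace Ω] [MetricSpace Ω] [CompactSpace Ω] [BorelSpace Ω]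
  {K : Ω → Ω → ℝ}

theorem energy_sum_mul (a : ℕ → ℝ) (g : ℕ → C(Ω, ℝ)) (n : ℕ) (ν : SignedMeasure Ω) :
    energy (fun x y => ∑ j ∈ Finset.range n, a j * g j x * g j y) ν =
      ∑ j ∈ Finset.range n, a j * (∫ᵛ x, g j x ∂<•ν) ^ 2 := by
  have h : ∀ y, ∫ᵛ x, (∑ j ∈ Finset.range n, a j * g j x * g j y) ∂<•ν =
      ∑ j ∈ Finset.range n, (a j * ∫ᵛ x, g j x ∂<•ν) * g j y := fun y => by
    rw [VectorMeasure.integral_finsetSum _ fun j _ => integrable_of_continuous (by fun_prop) _]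
    refine Finset.sum_congr rfl fun j _ => ?_
    simp_rw [fun x => show a j * g j x * g j y = (a j * g j y) * g j x by ring,
      signedIntegral_const_mul]
    ring
  simp only [energy, h]
  rw [VectorMeasure.integral_finsetSum _ fun j _ => integrable_of_continuous (by fun_prop) _]
  refine Finset.sum_congr rfl fun j _ => ?_
  rw [signedIntegral_const_mul]
  ring

/-- Uniform convergence bounds the partial sums eventually by `C + 1`, so bounded convergence
applies to both integrals in turn. -/
theorem tendsto_sum_mul_sq_energy (hK : IsKernel K) {a : ℕ → ℝ} {g : ℕ → C(Ω, ℝ)}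
    (h : TendstoUniformly
      (fun n (p : Ω × Ω) => ∑ j ∈ Finset.range n, a j * g j p.1 * g j p.2)
      (fun p => K p.1 p.2) atTop) (ν : SignedMeasure Ω) :
    Tendsto (fun n => ∑ j ∈ Finset.range n, a j * (∫ᵛ x, g j x ∂<•ν) ^ 2) atTop
      (𝓝 (energy K ν)) := by
  obtain ⟨C, hC⟩ := isCompact_univ.exists_bound_of_continuousOn hK.continuous.continuousOn
  have hker : ∀ n, IsKernel fun x y : Ω => ∑ j ∈ Finset.range n, a j * g j x * g j y := fun n =>
    ⟨by fun_prop, fun x y => Finset.sum_congr rfl fun j _ => by ring⟩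
  have hbound : ∀ᶠ n in atTop, ∀ x y,
      ‖∑ j ∈ Finset.range n, a j * g j x * g j y‖ ≤ C + 1 := by
    filter_upwards [Metric.tendstoUniformly_iff.1 h 1 one_pos] with n hn x y
    have h1 := hn (x, y)
    have h2 := hC (x, y) trivial
    rw [dist_comm, dist_eq_norm] at h1
    have h3 := norm_le_norm_add_norm_sub' (∑ j ∈ Finset.range n, a j * g j x * g j y) (K x y)
    simp only at h1 h2
    linarith
  simp_rw [← energy_sum_mul]
  refine VectorMeasure.tendsto_integral_filter_of_norm_le_const
    (.of_forall fun n => ((hker n).continuous_signedIntegral ν).aestronglyMeasurable)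
    ⟨_, hbound.mono fun n hn => .of_forall fun y =>
      VectorMeasure.norm_integral_le_of_norm_le_const (.of_forall fun x => hn x y)⟩
    (.of_forall fun y => ?_)
  exact VectorMeasure.tendsto_integral_filter_of_norm_le_const
    (.of_forall fun n => ((hker n).continuous_left y).aestronglyMeasurable)
    ⟨_, hbound.mono fun n hn => .of_forall fun x => hn x y⟩
    (.of_forall fun x => h.tendsto_at (x, y))

end UniformLimits

/-! ### From the Mercer expansion to conditional positivity -/

section Expansion

variable {Ω : Type*} [MeasurableSpace Ω]

/-- A family indexed by `1, …, dim L²(Ω, μ)`, extended by zero to a sequence. -/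
def extendByZero (μ : Measure Ω) {α : Type*} [Zero α] (f : L2Index μ → α) (j : ℕ) : α :=
  if h : (j : ℕ∞) < l2Dim μ then f ⟨j, h⟩ else 0

theorem extendByZero_coe (μ : Measure Ω) {α : Type*} [Zero α] (f : L2Index μ → α)
    (j : L2Index μ) : extendByZero μ f j = f j :=
  dif_pos j.2

variable [MetricSpace Ω] [CompactSpace Ω] [BorelSpace Ω] {K : Ω → Ω → ℝ}

theorem dite_mul_mul_eq (μ : Measure Ω) (lam : L2Index μ → ℝ) (φ : L2Index μ → C(Ω, ℝ)) (j : ℕ)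
    (x y : Ω) :
    (if h : (j : ℕ∞) < l2Dim μ then lam ⟨j, h⟩ * φ ⟨j, h⟩ x * φ ⟨j, h⟩ y else 0) =
      extendByZero μ lam j * extendByZero μ φ j x * extendByZero μ φ j y := by
  unfold extendByZero
  split_ifs <;> simp

theorem conditionallyStrictlyPositiveDefinite_of_isStrictMercerExpansion (hK : IsKernel K)
    {μ : Measure Ω} [IsFiniteMeasure μ] {lam : L2Index μ → ℝ} {φ : L2Index μ → C(Ω, ℝ)}
    (h : IsStrictMercerExpansion K μ lam φ)
    (hd : Dense (Submodule.span ℝ (Set.range φ) : Set C(Ω, ℝ))) :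
    ConditionallyStrictlyPositiveDefinite K := by
  set a := extendByZero μ lam
  set g := extendByZero μ φ
  have hunif := h.uniform
  simp_rw [dite_mul_mul_eq] at hunif
  have hterm : ∀ ν : SignedMeasure Ω, ν Set.univ = 0 → ∀ j,
      0 ≤ a j * (∫ᵛ x, g j x ∂<•ν) ^ 2 ∧
        (a j * (∫ᵛ x, g j x ∂<•ν) ^ 2 = 0 → ∫ᵛ x, g j x ∂<•ν = 0) := by
    intro ν hν j
    by_cases hj : (j : ℕ∞) < l2Dim μ
    · have ha : a j = lam ⟨j, hj⟩ := dif_pos hj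
      have hg : g j = φ ⟨j, hj⟩ := dif_pos hj
      -- The first eigenvalue may have any sign, but its eigenfunction is constant and integrates to
      -- zero against `ν`.
      rcases Nat.eq_zero_or_pos j with h0 | h0
      · obtain ⟨c, hc⟩ := h.const_first ⟨j, hj⟩ h0
        have : ∫ᵛ x, g j x ∂<•ν = 0 := by
          simp_rw [hg, hc, signedIntegral_const, hν, mul_zero]
        simp [this]
      · have hpos := h.pos ⟨j, hj⟩ h0
        rw [ha]
        refine ⟨by positivity, fun h1 => ?_⟩
        simpa [hpos.ne'] using h1
    · have hg : g j = 0 := dif_neg hj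
      simp [hg]
  refine ⟨fun ν hν => ?_, fun ν hν he => ?_⟩
  · exact ge_of_tendsto' (tendsto_sum_mul_sq_energy hK hunif ν)
      fun n => Finset.sum_nonneg fun j _ => (hterm ν hν j).1
  · have hlim := tendsto_sum_mul_sq_energy hK hunif ν
    have hmono : Monotone fun n => ∑ j ∈ Finset.range n, a j * (∫ᵛ x, g j x ∂<•ν) ^ 2 :=
      fun m n hmn => Finset.sum_le_sum_of_subset_of_nonneg (Finset.range_mono hmn)
        fun j _ _ => (hterm ν hν j).1
    have hzero : ∀ j, ∫ᵛ x, g j x ∂<•ν = 0 := fun j => by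
      refine (hterm ν hν j).2 (le_antisymm ?_ (hterm ν hν j).1)
      calc a j * (∫ᵛ x, g j x ∂<•ν) ^ 2
          ≤ ∑ i ∈ Finset.range (j + 1), a i * (∫ᵛ x, g i x ∂<•ν) ^ 2 :=
            Finset.single_le_sum (f := fun i => a i * (∫ᵛ x, g i x ∂<•ν) ^ 2)
              (fun i _ => (hterm ν hν i).1) (Finset.self_mem_range_succ j)
        _ ≤ energy K ν := hmono.ge_of_tendsto hlim (j + 1)
        _ = 0 := he
    have hspan : ∀ f ∈ Submodule.span ℝ (Set.range φ), ∫ᵛ x, f x ∂<•ν = 0 := fun f hf => by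
      induction hf using Submodule.span_induction with
      | mem f hf =>
        obtain ⟨j, rfl⟩ := hf
        rw [← hzero j, ← extendByZero_coe μ φ j]
      | zero => simp
      | add f f' _ _ h1 h2 =>
        simp only [ContinuousMap.add_apply]
        rw [signedIntegral_add f.continuous f'.continuous, h1, h2, add_zero]
      | smul c f _ h1 =>
        simp only [ContinuousMap.smul_apply, smul_eq_mul]
        rw [signedIntegral_const_mul, h1, mul_zero]
    -- Integration against `ν` is continuous in the supremum norm, so vanishing on the dense span
    -- forces vanishing on `C(Ω)`.
    have hcont : Continuous fun f : C(Ω, ℝ) => ∫ᵛ x, f x ∂<•ν := by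
      refine continuous_iff_continuousAt.2 fun f => ?_
      refine VectorMeasure.tendsto_integral_filter_of_norm_le_const
        (.of_forall fun f => f.continuous.aestronglyMeasurable) ⟨‖f‖ + 1, ?_⟩
        (.of_forall fun x => (continuous_eval_const x).tendsto f)
      filter_upwards [continuous_norm.continuousAt.eventually_lt continuousAt_const
        (lt_add_one ‖f‖)] with f' hf'
      exact .of_forall fun x => (f'.norm_coe_le_norm x).trans hf'.le
    refine eq_zero_of_forall_signedIntegral_eq_zero fun f => ?_
    exact congrFun (hcont.ext_on hd continuous_const fun f hf => hspan f hf) f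

end Expansion

/-! ### Orthonormal eigenvectors of compact symmetric operators -/

section Spectral

open Module.End

variable {E : Type*} [NormedAddCommGroup E] [InnerProductSpace ℝ E]

theorem _root_.Orthonormal.insert_subtype {s : Set E} (hs : Orthonormal ℝ ((↑) : s → E)) {v : E}
    (hv : ‖v‖ = 1) (hvs : ∀ w ∈ s, inner ℝ w v = 0) :
    Orthonormal ℝ ((↑) : ↥(insert v s) → E) := by
  constructor
  · rintro ⟨w, rfl | hw⟩
    · exact hv
    · exact hs.1 ⟨w, hw⟩
  · rintro ⟨w, rfl | hw⟩ ⟨u, rfl | hu⟩ hne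
    · exact absurd rfl hne
    · exact (real_inner_comm _ _).trans (hvs u hu)
    · exact hvs w hw
    · exact hs.2 (i := ⟨w, hw⟩) (j := ⟨u, hu⟩) fun h => hne (Subtype.ext (Subtype.mk.inj h : w = u))

/-- A unit eigenvector of a compact symmetric operator belongs to a complete orthonormal system of
eigenvectors. -/
theorem exists_orthonormal_eigenvectors [CompleteSpace E] {T : E →L[ℝ] E}
    (hc : IsCompactOperator T) (hs : T.IsSymmetric) {v : E} (hv : ‖v‖ = 1)
    (hTv : ∃ c : ℝ, T v = c • v) :
    ∃ s : Set E, v ∈ s ∧ Orthonormal ℝ ((↑) : s → E) ∧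
      (Submodule.span ℝ s).topologicalClosure = ⊤ ∧ ∀ w ∈ s, ∃ c : ℝ, T w = c • w := by
  obtain ⟨s, hvs, hmax⟩ := zorn_subset_nonempty
    {s : Set E | Orthonormal ℝ ((↑) : s → E) ∧ ∀ w ∈ s, ∃ c : ℝ, T w = c • w}
    (fun c hcs hchain _ => ⟨⋃₀ c,
      ⟨orthonormal_sUnion_of_directed hchain.directedOn fun a ha => (hcs ha).1,
        fun w ⟨a, ha, hw⟩ => (hcs ha).2 w hw⟩, fun a ha => Set.subset_sUnion_of_mem ha⟩)
    {v} ⟨⟨fun w => by rw [show (w : E) = v from w.2]; exact hv,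
      fun a b hab => absurd (Subsingleton.elim a b) hab⟩, by simpa using hTv⟩
  obtain ⟨⟨ho, he⟩, hmax⟩ := hmax
  refine ⟨s, by simpa using hvs, ho, ?_, he⟩
  rw [Submodule.topologicalClosure_eq_top_iff]
  -- The operator preserves `V` and restricts to a compact symmetric operator there. Were `V`
  -- nonzero, a unit eigenvector in it would enlarge the maximal set `s`.
  set V := (Submodule.span ℝ s)ᗮ with hV
  have hinner : ∀ x ∈ V, ∀ w ∈ s, inner ℝ w x = 0 := fun x hx w hw =>
    (Submodule.mem_orthogonal _ _).1 hx w (Submodule.subset_span hw)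
  have hinv : ∀ x ∈ V, T x ∈ V := fun x hx => by
    rw [hV, Submodule.mem_orthogonal]
    intro u hu
    induction hu using Submodule.span_induction with
    | mem w hw =>
      obtain ⟨c, hcw⟩ := he w hw
      have := hs w x
      simp only [ContinuousLinearMap.coe_coe] at this
      rw [← this, hcw, real_inner_smul_left, hinner x hx w hw, mul_zero]
    | zero => exact inner_zero_left _
    | add a b _ _ ha hb => rw [inner_add_left, ha, hb, add_zero]
    | smul c a _ ha => rw [real_inner_smul_left, ha, mul_zero]
  let S : V →L[ℝ] V := T.restrict hinv
  have hS := S.orthogonalComplement_iSup_eigenspaces_eq_bot (hc.restrict' hinv)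
    (hs.restrict_invariant hinv)
  by_contra hne
  have hex : ∃ c : ℝ, eigenspace (S : Module.End ℝ V) c ≠ ⊥ := by
    by_contra! hall
    simp only [hall, iSup_bot, Submodule.bot_orthogonal_eq_top] at hS
    exact hne ((Submodule.subsingleton_iff_eq_bot).1 (subsingleton_of_bot_eq_top hS.symm |>
      (Submodule.subsingleton_iff ℝ).1))
  obtain ⟨c, hc0⟩ := hex
  obtain ⟨x, hx, hx0⟩ := Submodule.exists_mem_ne_zero_of_ne_bot hc0
  rw [mem_eigenspace_iff] at hx
  have hTx : T x = c • (x : E) := congrArg Subtype.val hx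
  have hx0' : (x : E) ≠ 0 := by simpa using hx0
  set u : E := ‖(x : E)‖⁻¹ • (x : E)
  have hu1 : ‖u‖ = 1 := norm_smul_inv_norm hx0'
  have husV : u ∈ V := V.smul_mem _ x.2
  have hins := hmax (y := insert u s) ⟨ho.insert_subtype hu1 (hinner u husV), by
    rintro w (rfl | hw)
    · exact ⟨c, by simp only [u, map_smul, hTx, smul_comm c]⟩
    · exact he w hw⟩ (Set.subset_insert u s)
  have h0 := hinner u husV u (hins (Set.mem_insert u s))
  rw [real_inner_self_eq_norm_sq, hu1] at h0
  norm_num at h0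

/-- Distinct orthonormal vectors are at distance `√2`, so balls of radius `1/2` around them are
disjoint open sets. -/
theorem _root_.Orthonormal.countable_of_separableSpace [TopologicalSpace.SeparableSpace E]
    {s : Set E} (hs : Orthonormal ℝ ((↑) : s → E)) : s.Countable := by
  refine Set.PairwiseDisjoint.countable_of_isOpen (s := fun v : E => Metric.ball v (1 / 2))
    (a := s) ?_ (fun _ _ => Metric.isOpen_ball) fun v _ => ⟨v, Metric.mem_ball_self one_half_pos⟩
  intro v hv w hw hne
  refine Metric.ball_disjoint_ball ?_
  have h0 : inner ℝ v w = 0 := hs.2 (i := ⟨v, hv⟩) (j := ⟨w, hw⟩) fun h => hne (by simpa using h)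
  have h1 := norm_sub_sq_real v w
  have h2 : ‖v‖ = 1 := hs.1 ⟨v, hv⟩
  have h3 : ‖w‖ = 1 := hs.1 ⟨w, hw⟩
  rw [h0, h2, h3] at h1
  rw [dist_eq_norm]
  nlinarith [norm_nonneg (v - w)]

/-- A complete orthonormal system in a separable space is indexed by the natural numbers below the
dimension. -/
theorem nonempty_equiv_of_orthonormal_of_complete [CompleteSpace E]
    [TopologicalSpace.SeparableSpace E] {s : Set E} (hs : Orthonormal ℝ ((↑) : s → E))
    (hsp : (Submodule.span ℝ s).topologicalClosure = ⊤) :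
    Nonempty (s ≃ {j : ℕ // (j : ℕ∞) < Cardinal.toENat (Module.rank ℝ E)}) := by
  have hli := hs.linearIndependent
  by_cases hfin : s.Finite
  · have := hfin.to_subtype
    have hfd : FiniteDimensional ℝ (Submodule.span ℝ s) := FiniteDimensional.span_of_finite ℝ hfin
    have htop : Submodule.span ℝ s = ⊤ := by
      rw [← hsp]
      exact ((Submodule.span ℝ s).closed_of_finiteDimensional.submodule_topologicalClosure_eq).symm
    have hrank : Module.rank ℝ E = Nat.card s := by
      rw [← rank_top ℝ E, ← htop, rank_span_set hli, Nat.cast_card]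
    rw [hrank]
    simp only [map_natCast, Nat.cast_lt]
    exact ⟨(Finite.equivFin s).trans Fin.equivSubtype⟩
  · have hinf : Infinite s := Set.infinite_coe_iff.2 hfin
    have := hs.countable_of_separableSpace.to_subtype
    -- `Module.rank` is the algebraic dimension, possibly uncountable, but `Cardinal.toENat` sends
    -- every infinite cardinal to `⊤`.
    have hrank : Cardinal.toENat (Module.rank ℝ E) = ⊤ := by
      rw [Cardinal.toENat_eq_top]
      exact (Cardinal.aleph0_le_mk s).trans hli.cardinal_le_rank
    rw [hrank]
    obtain ⟨e⟩ : Nonempty (s ≃ ℕ) := nonempty_equiv_of_countable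
    exact ⟨e.trans (Equiv.subtypeUnivEquiv fun j => ENat.natCast_lt_top j).symm⟩

end Spectral

/-! ### The integral operator on `L²` and its eigenbases -/

section IntegralOperator

variable {Ω : Type*} [MeasurableSpace Ω] [MetricSpace Ω] [CompactSpace Ω] [BorelSpace Ω]
  {K : Ω → Ω → ℝ}

theorem integrable_l2 {μ : Measure Ω} [IsFiniteMeasure μ] (ψ : Lp ℝ 2 μ) : Integrable ψ μ :=
  (Lp.memLp ψ).integrable one_le_two

theorem hsOperator_congr {μ : Measure Ω} {ψ ψ' : Ω → ℝ} (h : ψ =ᵐ[μ] ψ') :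
    hsOperator K μ ψ = hsOperator K μ ψ' :=
  funext fun _ => integral_congr_ae (h.mono fun y hy => by simp only [hy])

/-- The sections `K(x, ·)` of a kernel, as a continuous map into `L²`. -/
def kernelSection (hK : IsKernel K) (μ : Measure Ω) [IsFiniteMeasure μ] : C(Ω, Lp ℝ 2 μ) where
  toFun x := ContinuousMap.toLp 2 μ ℝ
    (ContinuousMap.curry ⟨fun p : Ω × Ω => K p.1 p.2, hK.continuous⟩ x)
  continuous_toFun := (ContinuousMap.toLp 2 μ ℝ).continuous.comp (ContinuousMap.continuous _)

theorem inner_toLp_left {μ : Measure Ω} [IsFiniteMeasure μ] (f : C(Ω, ℝ)) (ψ : Lp ℝ 2 μ) :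
    inner ℝ (ContinuousMap.toLp 2 μ ℝ f) ψ = ∫ x, f x * ψ x ∂μ := by
  rw [L2.inner_def]
  refine integral_congr_ae ?_
  filter_upwards [ContinuousMap.coeFn_toLp (p := 2) (𝕜 := ℝ) μ f] with x hx
  rw [hx]
  simp [mul_comm]

theorem inner_kernelSection (hK : IsKernel K) (μ : Measure Ω) [IsFiniteMeasure μ] (x : Ω)
    (ψ : Lp ℝ 2 μ) : inner ℝ (kernelSection hK μ x) ψ = hsOperator K μ ψ x :=
  inner_toLp_left _ ψ

/-- The integral operator of a kernel, from `L²` to the continuous functions. -/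
def integralOperator (hK : IsKernel K) (μ : Measure Ω) [IsFiniteMeasure μ] :
    Lp ℝ 2 μ →L[ℝ] C(Ω, ℝ) :=
  LinearMap.mkContinuous
    { toFun := fun ψ => ⟨fun x => inner ℝ (kernelSection hK μ x) ψ,
        (kernelSection hK μ).continuous.inner continuous_const⟩
      map_add' := fun ψ ψ' => by ext x; exact inner_add_right (𝕜 := ℝ) (kernelSection hK μ x) ψ ψ'
      map_smul' := fun c ψ => by ext x; exact real_inner_smul_right (kernelSection hK μ x) ψ c }
    ‖kernelSection hK μ‖ fun ψ => by
      rw [ContinuousMap.norm_le _ (by positivity)]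
      intro x
      exact (norm_inner_le_norm (𝕜 := ℝ) (kernelSection hK μ x) ψ).trans (by
        gcongr; exact ContinuousMap.norm_coe_le_norm (kernelSection hK μ) x)

theorem integralOperator_apply (hK : IsKernel K) (μ : Measure Ω) [IsFiniteMeasure μ]
    (ψ : Lp ℝ 2 μ) (x : Ω) : integralOperator hK μ ψ x = hsOperator K μ ψ x :=
  inner_kernelSection hK μ x ψ

/-- Arzelà–Ascoli: by Cauchy–Schwarz the images of the unit ball are bounded by `‖k‖` and share the
modulus of continuity `‖k x - k y‖`, with `k` the section map into `L²`. -/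
theorem isCompactOperator_integralOperator (hK : IsKernel K) (μ : Measure Ω) [IsFiniteMeasure μ] :
    IsCompactOperator (integralOperator hK μ) := by
  set k := kernelSection hK μ
  let A : Set (BoundedContinuousFunction Ω ℝ) :=
    (fun ψ => BoundedContinuousFunction.mkOfCompact (integralOperator hK μ ψ)) ''
      Metric.closedBall 0 1
  have hA : ∀ ψ x, integralOperator hK μ ψ x = inner ℝ (k x) ψ := fun _ _ => rfl
  have hcomp : IsCompact (closure A) := by
    refine BoundedContinuousFunction.arzela_ascoli (Metric.closedBall 0 ‖k‖)
      (isCompact_closedBall 0 ‖k‖) A ?_ ?_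
    · rintro _ x ⟨ψ, hψ, rfl⟩
      rw [mem_closedBall_zero_iff] at hψ ⊢
      simp only [BoundedContinuousFunction.mkOfCompact_apply, hA]
      calc _ ≤ ‖k x‖ * ‖ψ‖ := norm_inner_le_norm _ _
        _ ≤ ‖k‖ * 1 := by gcongr; exact ContinuousMap.norm_coe_le_norm _ x
        _ = ‖k‖ := mul_one _
    · intro x
      refine Metric.equicontinuousAt_of_continuity_modulus (fun y => ‖k x - k y‖) ?_ _ ?_
      · have : Continuous fun y => ‖k x - k y‖ := by fun_prop
        simpa using this.tendsto x
      · refine .of_forall fun y => ?_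
        rintro ⟨_, ψ, hψ, rfl⟩
        rw [mem_closedBall_zero_iff] at hψ
        simp only [BoundedContinuousFunction.mkOfCompact_apply, hA]
        rw [dist_eq_norm, ← inner_sub_left]
        calc _ ≤ ‖k x - k y‖ * ‖ψ‖ := norm_inner_le_norm _ _
          _ ≤ ‖k x - k y‖ * 1 := by gcongr
          _ = _ := mul_one _
  refine ⟨_, hcomp.image (ContinuousMap.isometryEquivBoundedOfCompact Ω ℝ).symm.continuous, ?_⟩
  filter_upwards [Metric.closedBall_mem_nhds (0 : Lp ℝ 2 μ) one_pos] with ψ hψ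
  exact ⟨_, subset_closure ⟨ψ, hψ, rfl⟩, by ext x; rfl⟩

theorem signedIntegral_withDensityᵥ {μ : Measure Ω} [IsFiniteMeasure μ] {ψ : Ω → ℝ}
    (hψ : Integrable ψ μ) {f : Ω → ℝ} (hf : Continuous f) :
    ∫ᵛ x, f x ∂<•(μ.withDensityᵥ ψ) = ∫ x, f x * ψ x ∂μ := by
  have h1 := isFiniteMeasure_withDensity_ofReal hψ.2
  have h2 : IsFiniteMeasure (μ.withDensity fun x => ENNReal.ofReal (-ψ x)) :=
    isFiniteMeasure_withDensity_ofReal hψ.neg.2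
  obtain ⟨C, hC⟩ := isCompact_univ.exists_bound_of_continuousOn hf.continuousOn
  have hint : ∀ g : Ω → ℝ, Integrable g μ → Integrable (fun x => max (g x) 0 * f x) μ :=
    fun g hg => hg.pos_part.mul_bdd (c := C) hf.aestronglyMeasurable (.of_forall fun x => hC x trivial)
  have hone : ∀ g : Ω → ℝ, Integrable g μ →
      ∫ x, f x ∂(μ.withDensity fun x => ENNReal.ofReal (g x)) = ∫ x, max (g x) 0 * f x ∂μ :=
    fun g hg => by
      rw [integral_withDensity_eq_integral_toReal_smul₀ hg.aemeasurable.ennreal_ofReal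
        (.of_forall fun _ => ENNReal.ofReal_lt_top)]
      simp only [ENNReal.toReal_ofReal', smul_eq_mul]
  rw [withDensityᵥ_eq_withDensity_pos_part_sub_withDensity_neg_part hψ,
    VectorMeasure.integral_sub_vectorMeasure (integrable_of_continuous hf _)
      (integrable_of_continuous hf _), VectorMeasure.integral_toSignedMeasure,
    VectorMeasure.integral_toSignedMeasure, hone ψ hψ, hone (fun x => -ψ x) hψ.neg,
    ← integral_sub (hint ψ hψ) (hint (fun x => -ψ x) hψ.neg)]
  refine integral_congr_ae (.of_forall fun x => ?_)
  simp only
  rw [← sub_mul, show max (ψ x) 0 - max (-ψ x) 0 = ψ x from by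
    rcases le_total (ψ x) 0 with h | h <;> simp [h], mul_comm]

theorem IsKernel.potential_withDensityᵥ (hK : IsKernel K) {μ : Measure Ω} [IsFiniteMeasure μ]
    {ψ : Ω → ℝ} (hψ : Integrable ψ μ) (x : Ω) :
    potential K (μ.withDensityᵥ ψ) x = hsOperator K μ ψ x :=
  signedIntegral_withDensityᵥ hψ (hK.continuous_right x)

/-- The integral operator of a kernel on `L²`. -/
def l2Operator (hK : IsKernel K) (μ : Measure Ω) [IsFiniteMeasure μ] : Lp ℝ 2 μ →L[ℝ] Lp ℝ 2 μ :=
  (ContinuousMap.toLp 2 μ ℝ).comp (integralOperator hK μ)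

theorem coeFn_l2Operator (hK : IsKernel K) (μ : Measure Ω) [IsFiniteMeasure μ] (ψ : Lp ℝ 2 μ) :
    l2Operator hK μ ψ =ᵐ[μ] hsOperator K μ ψ :=
  (ContinuousMap.coeFn_toLp (p := 2) (𝕜 := ℝ) μ _).trans
    (.of_forall fun x => integralOperator_apply hK μ ψ x)

theorem l2Operator_eq_smul_iff (hK : IsKernel K) (μ : Measure Ω) [IsFiniteMeasure μ]
    (ψ : Lp ℝ 2 μ) (c : ℝ) :
    l2Operator hK μ ψ = c • ψ ↔ hsOperator K μ ψ =ᵐ[μ] fun x => c * ψ x := by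
  have h1 := coeFn_l2Operator hK μ ψ
  have h2 := Lp.coeFn_smul c ψ
  constructor
  · intro h
    rw [h] at h1
    exact h1.symm.trans h2
  · intro h
    exact Lp.ext (h1.trans (h.trans h2.symm))

/-- The bridge from operators to energies: identifying `ψ` with the signed measure `ψ dμ`, symmetry
and positivity of the energy pass to the operator. -/
theorem inner_l2Operator (hK : IsKernel K) (μ : Measure Ω) [IsFiniteMeasure μ]
    (ψ ξ : Lp ℝ 2 μ) : inner ℝ (l2Operator hK μ ψ) ξ =
      mutualEnergy K (μ.withDensityᵥ ψ) (μ.withDensityᵥ ξ) := by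
  rw [hK.mutualEnergy_eq, signedIntegral_withDensityᵥ (integrable_l2 ξ)
    (hK.continuous_potential _)]
  simp_rw [hK.potential_withDensityᵥ (integrable_l2 ψ), ← integralOperator_apply hK]
  exact inner_toLp_left _ ξ

theorem isSymmetric_l2Operator (hK : IsKernel K) (μ : Measure Ω) [IsFiniteMeasure μ] :
    (l2Operator hK μ).IsSymmetric := fun ψ ξ => by
  simp only [ContinuousLinearMap.coe_coe]
  rw [inner_l2Operator, real_inner_comm, inner_l2Operator, hK.mutualEnergy_comm]

theorem isCompactOperator_l2Operator (hK : IsKernel K) (μ : Measure Ω) [IsFiniteMeasure μ] :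
    IsCompactOperator (l2Operator hK μ) :=
  (isCompactOperator_integralOperator hK μ).clm_comp (ContinuousMap.toLp 2 μ ℝ)

variable {μ : Measure Ω} [IsProbabilityMeasure μ]

theorem toLp_eq_iff {μ : Measure Ω} [IsFiniteMeasure μ] (f : C(Ω, ℝ)) (ψ : Lp ℝ 2 μ) :
    ContinuousMap.toLp 2 μ ℝ f = ψ ↔ ψ =ᵐ[μ] f := by
  have h := ContinuousMap.coeFn_toLp (p := 2) (𝕜 := ℝ) μ f
  exact ⟨fun h' => h' ▸ h, fun h' => Lp.ext (h.trans h'.symm)⟩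

theorem norm_toLp_const (μ : Measure Ω) [IsProbabilityMeasure μ] (c : ℝ) :
    ‖ContinuousMap.toLp 2 μ ℝ (ContinuousMap.const Ω c)‖ = |c| := by
  rw [← sq_eq_sq₀ (norm_nonneg _) (abs_nonneg c), ← real_inner_self_eq_norm_sq,
    ContinuousMap.inner_toLp]
  simp [sq]

theorem hsOperator_const_of_isInvariant (hμ : IsInvariant K μ) (c : ℝ) (x : Ω) :
    hsOperator K μ (fun _ => c) x = energy K μ.toSignedMeasure * c := by
  rw [← hμ x, potential, VectorMeasure.integral_toSignedMeasure, ← integral_mul_const, hsOperator]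

theorem l2Operator_const_of_isInvariant (hK : IsKernel K) (hμ : IsInvariant K μ) (c : ℝ) :
    l2Operator hK μ (ContinuousMap.toLp 2 μ ℝ (ContinuousMap.const Ω c)) =
      energy K μ.toSignedMeasure • ContinuousMap.toLp 2 μ ℝ (ContinuousMap.const Ω c) := by
  rw [l2Operator_eq_smul_iff]
  have h := ContinuousMap.coeFn_toLp (p := 2) (𝕜 := ℝ) μ (ContinuousMap.const Ω c)
  rw [hsOperator_congr (ψ' := fun _ => c) h]
  filter_upwards [h] with x hx
  rw [hx, hsOperator_const_of_isInvariant hμ]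
  rfl

theorem l2Dim_pos (μ : Measure Ω) [IsProbabilityMeasure μ] : ((0 : ℕ) : ℕ∞) < l2Dim μ := by
  have : Nontrivial (Lp ℝ 2 μ) := 
    ⟨ContinuousMap.toLp 2 μ ℝ (ContinuousMap.const Ω (1 : ℝ)), 0, fun h => by
      have := norm_toLp_const μ 1
      rw [h] at this
      simp at this⟩
  rw [Nat.cast_zero, pos_iff_ne_zero, l2Dim, Ne, Cardinal.toENat_eq_zero]
  exact (rank_pos (R := ℝ) (M := Lp ℝ 2 μ)).ne'

/-- There is an orthonormal basis of eigenfunctions starting with a constant function. -/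
theorem exists_isEigenbasis (hK : IsKernel K) (hμ : IsInvariant K μ) :
    ∃ (lam : L2Index μ → ℝ) (e : L2Index μ → Lp ℝ 2 μ), IsEigenbasis K μ lam e ∧
      ∀ j : L2Index μ, j.1 = 0 → ∃ c : ℝ, e j =ᵐ[μ] fun _ => c := by
  set v := ContinuousMap.toLp 2 μ ℝ (ContinuousMap.const Ω (1 : ℝ))
  obtain ⟨s, hvs, ho, hsp, he⟩ := exists_orthonormal_eigenvectors
    (isCompactOperator_l2Operator hK μ) (isSymmetric_l2Operator hK μ)
    ((norm_toLp_const μ 1).trans abs_one) ⟨_, l2Operator_const_of_isInvariant hK hμ 1⟩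
  have : Fact ((2 : ℝ≥0∞) ≠ ⊤) := ⟨ENNReal.ofNat_ne_top⟩
  obtain ⟨σ⟩ : Nonempty (s ≃ L2Index μ) := nonempty_equiv_of_orthonormal_of_complete ho hsp
  let zero : L2Index μ := ⟨0, l2Dim_pos μ⟩
  classical
  -- The swap moves the constant eigenvector to index `0`.
  let τ : L2Index μ ≃ s := (Equiv.swap zero (σ ⟨v, hvs⟩)).trans σ.symm
  have hτ : (τ zero : Lp ℝ 2 μ) = v := by simp [τ]
  choose! lam hlam using he
  refine ⟨fun j => lam (τ j), fun j => τ j, ⟨ho.comp _ τ.injective, ?_, fun j => ?_⟩, ?_⟩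
  · rw [show Set.range (fun j => (τ j : Lp ℝ 2 μ)) = s by
      rw [show (fun j => (τ j : Lp ℝ 2 μ)) = Subtype.val ∘ τ from rfl, τ.surjective.range_comp,
        Subtype.range_coe]]
    exact hsp
  · exact (l2Operator_eq_smul_iff hK μ _ _).1 (hlam _ (τ j).2)
  · intro j hj
    obtain rfl : j = zero := Subtype.ext hj
    exact ⟨1, by
      change (τ zero : Lp ℝ 2 μ) =ᵐ[μ] _
      rw [hτ]
      exact ContinuousMap.coeFn_toLp (p := 2) (𝕜 := ℝ) μ _⟩

end IntegralOperator

/-! ### Mercer's theorem for positive semidefinite kernels -/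

section Mercer

variable {Ω : Type*} [MeasurableSpace Ω] [MetricSpace Ω] [CompactSpace Ω] [BorelSpace Ω]
  {K : Ω → Ω → ℝ} {μ : Measure Ω} [IsFiniteMeasure μ] {ι : Type*} {a : ι → ℝ} {φ : ι → C(Ω, ℝ)}

theorem integrable_continuousMap (f : C(Ω, ℝ)) : Integrable f μ :=
  integrable_of_continuous f.continuous μ

theorem signedIntegral_dirac (x : Ω) (f : Ω → ℝ) :
    ∫ᵛ y, f y ∂<•(VectorMeasure.dirac x (1 : ℝ)) = f x := by
  rw [VectorMeasure.integral_dirac]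
  simp

/-- Bessel's inequality for the feature expansion of a positive definite kernel. -/
theorem sum_mul_sq_le_diag (hK : IsKernel K) (hpos : ∀ ν : SignedMeasure Ω, 0 ≤ energy K ν)
    (ho : Orthonormal ℝ fun j => ContinuousMap.toLp 2 μ ℝ (φ j))
    (heig : ∀ j x, hsOperator K μ (φ j) x = a j * φ j x) (s : Finset ι) (x : Ω) :
    ∑ j ∈ s, a j * φ j x ^ 2 ≤ K x x := by
  classical
  -- The measure `f dμ` is the formal projection of `δ_x` onto the span of the `φ j`. Both its
  -- energy and its mutual energy with `δ_x` equal the partial sum, so positivity at `δ_x - f dμ` is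
  -- the claim.
  set f : C(Ω, ℝ) := ∑ j ∈ s, φ j x • φ j
  set δ : SignedMeasure Ω := VectorMeasure.dirac x (1 : ℝ)
  have hf : ∀ y, f y = ∑ j ∈ s, φ j x * φ j y := fun y => by
    simp [f]
  have hpot : ∀ y, potential K (μ.withDensityᵥ f) y = ∑ j ∈ s, a j * φ j x * φ j y := fun y => by
    rw [hK.potential_withDensityᵥ (integrable_continuousMap f), hsOperator]
    simp_rw [hf, Finset.mul_sum]
    have hint : ∀ j ∈ s, Integrable (fun z => K y z * (φ j x * φ j z)) μ := fun j _ =>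
      integrable_of_continuous ((hK.continuous_right y).mul (by fun_prop)) μ
    rw [integral_finsetSum _ hint]
    refine Finset.sum_congr rfl fun j _ => ?_
    simp_rw [mul_left_comm _ (φ j x), integral_const_mul]
    rw [show ∫ z, K y z * φ j z ∂μ = a j * φ j y from heig j y]
    ring
  have h1 : mutualEnergy K (μ.withDensityᵥ f) δ = ∑ j ∈ s, a j * φ j x ^ 2 := by
    rw [hK.mutualEnergy_eq, signedIntegral_dirac, hpot]
    exact Finset.sum_congr rfl fun j _ => by ring
  have horth : ∀ i j, ∫ y, φ i y * φ j y ∂μ = if i = j then 1 else 0 := fun i j => by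
    have := orthonormal_iff_ite.1 ho j i
    rw [ContinuousMap.inner_toLp] at this
    simpa [eq_comm] using this
  have h2 : energy K (μ.withDensityᵥ f) = ∑ j ∈ s, a j * φ j x ^ 2 := by
    rw [← mutualEnergy_self, hK.mutualEnergy_eq, signedIntegral_withDensityᵥ
      (integrable_continuousMap f) (hK.continuous_potential _)]
    simp_rw [hpot, hf, Finset.sum_mul_sum]
    rw [integral_finsetSum _ fun j _ => integrable_of_continuous (by fun_prop) μ]
    refine Finset.sum_congr rfl fun i hi => ?_
    rw [integral_finsetSum _ fun j _ => integrable_of_continuous (by fun_prop) μ]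
    simp_rw [fun j y => show a i * φ i x * φ i y * (φ j x * φ j y) =
      (a i * φ i x * φ j x) * (φ i y * φ j y) by ring, integral_const_mul, horth]
    simp only [mul_ite, mul_one, mul_zero, Finset.sum_ite_eq, hi, if_true]
    ring
  have h3 : energy K δ = K x x := by
    rw [← mutualEnergy_self, mutualEnergy]
    simp_rw [δ, signedIntegral_dirac]
  have := hpos (δ - μ.withDensityᵥ f)
  rw [hK.energy_sub, hK.mutualEnergy_comm, h1, h2, h3] at this
  linarith

theorem summable_mul_sq (ha : ∀ j, 0 ≤ a j) {x : Ω}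
    (hb : ∀ s : Finset ι, ∑ j ∈ s, a j * φ j x ^ 2 ≤ K x x) :
    Summable fun j => a j * φ j x ^ 2 :=
  summable_of_sum_le (fun j => mul_nonneg (ha j) (sq_nonneg _)) hb

theorem summable_abs_mul_mul (ha : ∀ j, 0 ≤ a j)
    (hb : ∀ (s : Finset ι) (x : Ω), ∑ j ∈ s, a j * φ j x ^ 2 ≤ K x x) (x y : Ω) :
    Summable fun j => |a j * φ j x * φ j y| := by
  refine Summable.of_nonneg_of_le (fun _ => abs_nonneg _) (fun j => ?_)
    ((summable_mul_sq ha (hb · x)).add (summable_mul_sq ha (hb · y)))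
  have h1 := mul_nonneg (ha j) (sq_nonneg (φ j x - φ j y))
  have h2 := mul_nonneg (ha j) (sq_nonneg (φ j x + φ j y))
  have h3 := mul_nonneg (ha j) (sq_nonneg (φ j x))
  have h4 := mul_nonneg (ha j) (sq_nonneg (φ j y))
  rw [abs_le]
  constructor <;> nlinarith

/-- By Cauchy–Schwarz a tail at `y` is at most the diagonal tail at `x` times the bounded diagonal
at `y`. The convergence is uniform in `y` for fixed `x` only; joint uniformity comes later. -/
theorem summable_smul_of_sum_mul_sq_le (hK : IsKernel K) (ha : ∀ j, 0 ≤ a j)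
    (hb : ∀ (s : Finset ι) (x : Ω), ∑ j ∈ s, a j * φ j x ^ 2 ≤ K x x) (x : Ω) :
    Summable fun j => (a j * φ j x) • φ j := by
  obtain ⟨C, hC⟩ := isCompact_univ.exists_bound_of_continuousOn hK.continuous.continuousOn
  have hdiag : ∀ y, K y y ≤ |C| := fun y =>
    (le_abs_self _).trans ((hC (y, y) trivial).trans (le_abs_self C))
  rw [summable_iff_vanishing_norm]
  intro ε hε
  have hC1 : 0 < |C| + 1 := by positivity
  obtain ⟨s, hs⟩ := summable_iff_vanishing_norm.1 (summable_mul_sq ha (hb · x))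
    (ε ^ 2 / (|C| + 1)) (by positivity)
  refine ⟨s, fun t ht => ?_⟩
  rw [ContinuousMap.norm_lt_iff _ hε]
  intro y
  have h1 := (le_abs_self _).trans_lt (hs t ht)
  have h2 : (∑ j ∈ t, a j * φ j x * φ j y) ^ 2 ≤
      (∑ j ∈ t, a j * φ j x ^ 2) * ∑ j ∈ t, a j * φ j y ^ 2 := by
    have h := Finset.sum_mul_sq_le_sq_mul_sq t (fun j => √(a j) * φ j x) fun j => √(a j) * φ j y
    simp_rw [mul_pow, Real.sq_sqrt (ha _)] at h
    refine le_of_eq_of_le ?_ h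
    congr 1
    refine Finset.sum_congr rfl fun j _ => ?_
    rw [mul_mul_mul_comm, Real.mul_self_sqrt (ha j), mul_assoc]
  have h3 : 0 ≤ ∑ j ∈ t, a j * φ j x ^ 2 :=
    Finset.sum_nonneg fun j _ => mul_nonneg (ha j) (sq_nonneg _)
  have h4 : (∑ j ∈ t, a j * φ j x * φ j y) ^ 2 < ε ^ 2 := by
    calc _ ≤ (∑ j ∈ t, a j * φ j x ^ 2) * (|C| + 1) := by
          refine h2.trans (mul_le_mul_of_nonneg_left ?_ h3)
          exact ((hb t y).trans (hdiag y)).trans (by linarith)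
      _ < ε ^ 2 / (|C| + 1) * (|C| + 1) := by gcongr
      _ = ε ^ 2 := div_mul_cancel₀ _ hC1.ne'
  have h5 := abs_lt_of_sq_lt_sq h4 hε.le
  simpa [ContinuousMap.sum_apply, Real.norm_eq_abs] using h5

/-- The series converges uniformly in `y`, and its `L²` class is the Fourier expansion of `K(x, ·)`.
Since `μ` charges every nonempty open set, equality in `L²` of continuous functions is equality
everywhere. -/
theorem hasSum_mul_mul (hK : IsKernel K) [μ.IsOpenPosMeasure] (ha : ∀ j, 0 ≤ a j)
    (hb : ∀ (s : Finset ι) (x : Ω), ∑ j ∈ s, a j * φ j x ^ 2 ≤ K x x)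
    (ho : Orthonormal ℝ fun j => ContinuousMap.toLp 2 μ ℝ (φ j))
    (hsp : (Submodule.span ℝ (Set.range fun j =>
      ContinuousMap.toLp 2 μ ℝ (φ j))).topologicalClosure = ⊤)
    (heig : ∀ j x, hsOperator K μ (φ j) x = a j * φ j x) (x y : Ω) :
    HasSum (fun j => a j * φ j x * φ j y) (K x y) := by
  obtain ⟨g, hg⟩ := summable_smul_of_sum_mul_sq_le hK ha hb x
  let b := HilbertBasis.mk ho hsp.ge
  have h1 := b.hasSum_repr (kernelSection hK μ x)
  have hterm : ∀ j, b.repr (kernelSection hK μ x) j • b j =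
      ContinuousMap.toLp 2 μ ℝ ((a j * φ j x) • φ j) := fun j => by
    rw [b.repr_apply_apply, HilbertBasis.coe_mk, real_inner_comm, inner_kernelSection, map_smul,
      hsOperator_congr (ContinuousMap.coeFn_toLp (p := 2) (𝕜 := ℝ) μ (φ j)), heig]
  simp_rw [hterm] at h1
  have h2 := h1.unique (hg.mapL (ContinuousMap.toLp 2 μ ℝ))
  have h3 := ContinuousMap.toLp_injective (p := 2) (𝕜 := ℝ) μ h2
  have h4 := hg.mapL (ContinuousMap.evalCLM ℝ y)
  rw [← h3] at h4
  exact h4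

/-- **Mercer's theorem**: uniform convergence of the eigenfunction expansion. -/
theorem tendstoUniformly_sum_mul_mul (hK : IsKernel K) (ha : ∀ j, 0 ≤ a j)
    (hsum : ∀ x y, HasSum (fun j => a j * φ j x * φ j y) (K x y)) :
    TendstoUniformly (fun (s : Finset ι) (p : Ω × Ω) => ∑ j ∈ s, a j * φ j p.1 * φ j p.2)
      (fun p => K p.1 p.2) atTop := by
  have hdiag : TendstoUniformly (fun (s : Finset ι) (x : Ω) => ∑ j ∈ s, a j * φ j x * φ j x)
      (fun x => K x x) atTop := by
    -- Dini's theorem: on the diagonal the terms are nonnegative and the limit is continuous.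
    refine Monotone.tendstoUniformly_of_forall_tendsto (fun s => by fun_prop) ?_
      (hK.continuous.comp (by fun_prop : Continuous fun x : Ω => (x, x))) fun x => hsum x x
    intro s t hst x
    refine Finset.sum_le_sum_of_subset_of_nonneg hst fun j _ _ => ?_
    rw [mul_assoc]
    exact mul_nonneg (ha j) (mul_self_nonneg _)
  rw [Metric.tendstoUniformly_iff] at hdiag ⊢
  intro ε hε
  filter_upwards [hdiag ε hε] with s hs
  rintro ⟨x, y⟩
  have hx := hs x
  have hy := hs y
  rw [Real.dist_eq, abs_lt] at hx hy ⊢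
  -- The remainder `R` is positive semidefinite, so `2|R(x, y)| ≤ R(x, x) + R(y, y)`; the two signs
  -- are treated separately.
  have hplus : 2 * ∑ j ∈ s, a j * φ j x * φ j y + (∑ j ∈ s, a j * φ j x * φ j x +
      ∑ j ∈ s, a j * φ j y * φ j y) ≤ 2 * K x y + (K x x + K y y) := by
    rw [Finset.mul_sum, ← Finset.sum_add_distrib, ← Finset.sum_add_distrib]
    refine sum_le_hasSum s (fun j _ => ?_) (((hsum x y).mul_left 2).add ((hsum x x).add (hsum y y)))
    nlinarith [mul_nonneg (ha j) (sq_nonneg (φ j x + φ j y))]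
  have hminus : (-2) * ∑ j ∈ s, a j * φ j x * φ j y + (∑ j ∈ s, a j * φ j x * φ j x +
      ∑ j ∈ s, a j * φ j y * φ j y) ≤ (-2) * K x y + (K x x + K y y) := by
    rw [Finset.mul_sum, ← Finset.sum_add_distrib, ← Finset.sum_add_distrib]
    refine sum_le_hasSum s (fun j _ => ?_)
      (((hsum x y).mul_left (-2)).add ((hsum x x).add (hsum y y)))
    nlinarith [mul_nonneg (ha j) (sq_nonneg (φ j x - φ j y))]
  simp only
  constructor <;> linarith [hx.1, hx.2, hy.1, hy.2]

end Mercer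

/-! ### The strict Mercer expansion of a conditionally positive kernel -/

section StrictExpansion

variable {Ω : Type*} [MeasurableSpace Ω] [MetricSpace Ω] [CompactSpace Ω] [BorelSpace Ω]
  {K : Ω → Ω → ℝ} {μ : Measure Ω} [IsProbabilityMeasure μ]

theorem isOpenPosMeasure_of_support_eq_univ {μ : Measure Ω} (h : μ.support = Set.univ) :
    μ.IsOpenPosMeasure := by
  refine ⟨fun U hU ⟨x, hx⟩ => ?_⟩
  have hxs : x ∈ μ.support := h ▸ Set.mem_univ x
  exact ((Measure.mem_support_iff_forall x).1 hxs U (hU.mem_nhds hx)).ne'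

/-- For a unit eigenfunction, `c` is the energy of `ψ dμ`, a nonzero signed measure of mass zero. -/
theorem eigenvalue_pos (hK : IsKernel K) (h : ConditionallyStrictlyPositiveDefinite K)
    {ψ : Lp ℝ 2 μ} (hψ : ‖ψ‖ = 1) (hint : ∫ x, ψ x ∂μ = 0) {c : ℝ}
    (hc : hsOperator K μ ψ =ᵐ[μ] fun x => c * ψ x) : 0 < c := by
  rw [conditionallyStrictlyPositiveDefinite_iff] at h
  have h1 := inner_l2Operator hK μ ψ ψ
  rw [(l2Operator_eq_smul_iff hK μ ψ c).2 hc, real_inner_smul_left, real_inner_self_eq_norm_sq,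
    hψ, one_pow, mul_one, mutualEnergy_self] at h1
  rw [h1]
  refine h _ ?_ fun h0 => ?_
  · rw [withDensityᵥ_apply (integrable_l2 ψ) MeasurableSet.univ, setIntegral_univ, hint]
  · have h2 : ψ =ᵐ[μ] (0 : Ω → ℝ) := (integrable_l2 ψ).ae_eq_of_withDensityᵥ_eq
      (integrable_zero _ _ _) (by rw [h0, withDensityᵥ_zero])
    have h3 : ψ = 0 := (Lp.eq_zero_iff_ae_eq_zero).2 h2
    rw [h3, norm_zero] at hψ
    exact zero_ne_one hψ

/-- The initial segments of the index set of `L²(Ω, μ)`. -/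
def initialIndices (μ : Measure Ω) (n : ℕ) : Finset (L2Index μ) :=
  open scoped Classical in (Finset.range n).subtype fun j : ℕ => (j : ℕ∞) < l2Dim μ

/-- Turns uniform convergence along all finite index sets into convergence of the ordered partial
sums. -/
theorem tendsto_initialIndices (μ : Measure Ω) : Tendsto (initialIndices μ) atTop atTop := by
  refine tendsto_atTop_finset_of_monotone (fun m n hmn j hj => ?_) fun j => ⟨j.1 + 1, ?_⟩
  · simp only [initialIndices, Finset.mem_subtype, Finset.mem_range] at hj ⊢
    omega
  · simp [initialIndices]

theorem sum_range_dite_eq (μ : Measure Ω) (f : L2Index μ → ℝ) (n : ℕ) :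
    (∑ j ∈ Finset.range n, if h : (j : ℕ∞) < l2Dim μ then f ⟨j, h⟩ else 0) =
      ∑ j ∈ initialIndices μ n, f j := by
  classical
  rw [← Finset.sum_filter_of_ne (p := fun j : ℕ => (j : ℕ∞) < l2Dim μ)
    (fun j _ hj => by by_contra h; exact hj (dif_neg h)), ← Finset.sum_subtype_eq_sum_filter]
  refine Finset.sum_congr (by ext; simp [initialIndices]) fun j _ => dif_pos j.2

theorem exists_isStrictMercerExpansion (hK : IsKernel K) (hμ : IsInvariant K μ)
    (hsupp : μ.support = Set.univ) (h : ConditionallyStrictlyPositiveDefinite K)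
    {lam : L2Index μ → ℝ} {e : L2Index μ → Lp ℝ 2 μ} (he : IsEigenbasis K μ lam e)
    (he0 : ∀ j : L2Index μ, j.1 = 0 → ∃ c : ℝ, e j =ᵐ[μ] fun _ => c) :
    ∃ φ : L2Index μ → C(Ω, ℝ), (∀ j, ContinuousMap.toLp 2 μ ℝ (φ j) = e j) ∧
      IsStrictMercerExpansion K μ lam φ := by
  have := isOpenPosMeasure_of_support_eq_univ hsupp
  classical
  set I := energy K μ.toSignedMeasure with hI
  let o : L2Index μ := ⟨0, l2Dim_pos μ⟩
  obtain ⟨c, hc⟩ := he0 o rfl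
  have hco : ContinuousMap.toLp 2 μ ℝ (ContinuousMap.const Ω c) = e o := (toLp_eq_iff _ _).2 hc
  have hc1 : |c| = 1 := by rw [← norm_toLp_const μ c, hco, he.orthonormal.1 o]
  have hc0 : c ≠ 0 := fun h0 => by simp [h0] at hc1
  have hcc : c * c = 1 := by rw [← abs_mul_abs_self, hc1, one_mul]
  have hT : ∀ j, l2Operator hK μ (e j) = lam j • e j := fun j =>
    (l2Operator_eq_smul_iff hK μ _ _).2 (he.eigen j)
  have hlam0 : lam o = I := by
    have h1 := hT o
    rw [← hco, l2Operator_const_of_isInvariant hK hμ, hco] at h1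
    exact (smul_left_injective ℝ (he.orthonormal.ne_zero o) h1).symm
  have hint : ∀ j, j ≠ o → ∫ x, e j x ∂μ = 0 := fun j hj => by
    have h1 : inner ℝ (e o) (e j) = 0 := he.orthonormal.2 hj.symm
    rw [← hco, inner_toLp_left] at h1
    simp only [ContinuousMap.const_apply, integral_const_mul] at h1
    exact (mul_eq_zero.1 h1).resolve_left hc0
  have hpos : ∀ j, j ≠ o → 0 < lam j := fun j hj =>
    eigenvalue_pos hK h (he.orthonormal.1 j) (hint j hj) (he.eigen j)
  -- Dividing `T e_j` by `lam j` gives a continuous representative. The first index needs its own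
  -- case, since its eigenvalue `I` may be zero.
  let φ : L2Index μ → C(Ω, ℝ) := fun j =>
    if j = o then ContinuousMap.const Ω c else (lam j)⁻¹ • integralOperator hK μ (e j)
  have hφo : φ o = ContinuousMap.const Ω c := if_pos rfl
  have hφ : ∀ j, j ≠ o → φ j = (lam j)⁻¹ • integralOperator hK μ (e j) := fun j hj => if_neg hj
  have hφe : ∀ j, ContinuousMap.toLp 2 μ ℝ (φ j) = e j := fun j => by
    by_cases hj : j = o
    · rw [hj, hφo, hco]
    · rw [hφ j hj, map_smul]
      exact (congrArg _ (hT j)).trans (inv_smul_smul₀ (hpos j hj).ne' _)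
  have hφe' : (fun j => ContinuousMap.toLp 2 μ ℝ (φ j)) = e := funext hφe
  have hae : ∀ j, φ j =ᵐ[μ] e j := fun j => ((toLp_eq_iff _ _).1 (hφe j)).symm
  have heigK : ∀ j, j ≠ o → ∀ x, hsOperator K μ (φ j) x = lam j * φ j x := fun j hj x => by
    rw [hsOperator_congr (hae j), ← integralOperator_apply hK, hφ j hj]
    simp [(hpos j hj).ne']
  let L : Ω → Ω → ℝ := fun x y => K x y + -I
  have hL : IsKernel L := hK.add_const _
  -- These are the eigenvalues of `L`: subtracting `I` annihilates constants and does not affect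
  -- functions of mean zero.
  let a : L2Index μ → ℝ := fun j => if j = o then 0 else lam j
  have ha : ∀ j, 0 ≤ a j := fun j => by
    by_cases hj : j = o
    · simp [a, hj]
    · simp only [a, hj, if_false]
      exact (hpos j hj).le
  have hLsplit : ∀ (f : C(Ω, ℝ)) x,
      hsOperator L μ f x = hsOperator K μ f x + -I * ∫ y, f y ∂μ := fun f x => by
    simp only [hsOperator, L, add_mul]
    have hKf : Integrable (fun y => K x y * f y) μ :=
      integrable_of_continuous ((hK.continuous_right x).mul f.continuous) μ
    rw [integral_add hKf ((integrable_continuousMap f).const_mul _), integral_const_mul]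
  have heig : ∀ j x, hsOperator L μ (φ j) x = a j * φ j x := fun j x => by
    rw [hLsplit]
    by_cases hj : j = o
    · rw [hj, hφo]
      have h1 := hsOperator_const_of_isInvariant hμ c x
      simp only [a, if_true, zero_mul]
      rw [show (⇑(ContinuousMap.const Ω c)) = fun _ => c from rfl, h1]
      simp [hI]
    · rw [heigK j hj, integral_congr_ae (hae j), hint j hj, mul_zero, add_zero]
      simp [a, hj]
  have ho : Orthonormal ℝ fun j => ContinuousMap.toLp 2 μ ℝ (φ j) := hφe' ▸ he.orthonormal
  have hsp : (Submodule.span ℝ (Set.range fun j =>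
      ContinuousMap.toLp 2 μ ℝ (φ j))).topologicalClosure = ⊤ := hφe' ▸ he.complete
  have hb : ∀ (s : Finset (L2Index μ)) (x : Ω), ∑ j ∈ s, a j * φ j x ^ 2 ≤ L x x :=
    sum_mul_sq_le_diag hL (energy_sub_const_nonneg hK hμ h) ho heig
  have hunif := tendstoUniformly_sum_mul_mul hL ha (hasSum_mul_mul hL ha hb ho hsp heig)
  -- As `c * c = 1`, the first term of the series for `K` is exactly the constant `I` by which `K`
  -- and `L` differ.
  have hterm : ∀ j x y, lam j * φ j x * φ j y = a j * φ j x * φ j y + if j = o then I else 0 :=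
    fun j x y => by
      by_cases hj : j = o
      · simp only [a, hj, if_true, hφo, ContinuousMap.const_apply, hlam0, mul_assoc, hcc]
        ring
      · simp [a, hj]
  refine ⟨φ, hφe, ⟨hφe' ▸ he, fun j hj => ⟨c, fun x => ?_⟩, fun j hj => hpos j ?_,
    fun x y => ?_, ?_⟩⟩
  · obtain rfl : j = o := Subtype.ext hj
    rw [hφo, ContinuousMap.const_apply]
  · rintro rfl
    exact absurd hj (by simp [o])
  · refine Summable.of_nonneg_of_le (fun _ => abs_nonneg _) (fun j => ?_)
      ((summable_abs_mul_mul ha hb x y).add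
        (summable_of_ne_finset_zero (s := {o}) (f := fun j => |if j = o then I else 0|) ?_))
    · rw [hterm]
      exact abs_add_le _ _
    · intro j hj
      simp [Finset.notMem_singleton.1 hj]
  · rw [Metric.tendstoUniformly_iff] at hunif ⊢
    intro ε hε
    have h1 := (tendsto_initialIndices μ).eventually (hunif ε hε)
    -- The constant `I` is present only once the partial sum contains the first index.
    have h2 := (tendsto_initialIndices μ).eventually (eventually_ge_atTop {o})
    filter_upwards [h1, h2] with n hn hon p
    have h3 := hn p
    rw [sum_range_dite_eq μ fun j => lam j * φ j p.1 * φ j p.2]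
    simp_rw [hterm, Finset.sum_add_distrib, Finset.sum_ite_eq']
    rw [if_pos (hon (Finset.mem_singleton_self o))]
    rw [Real.dist_eq] at h3 ⊢
    convert h3 using 2
    simp only [L]
    ring

end StrictExpansion

end EnergyKernel

end

theorem theorem4p3 {Ω : Type*} [MetricSpace Ω] [CompactSpace Ω] [MeasurableSpace Ω] [BorelSpace Ω]
    (K : Ω → Ω → ℝ) (hK : EnergyKernel.IsKernel K)
    (μ : Measure Ω) [IsProbabilityMeasure μ] (hμ : EnergyKernel.IsInvariant K μ) :
    List.TFAE
      [EnergyKernel.ConditionallyStrictlyPositiveDefinite K,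
       EnergyKernel.StrictlyPositiveDefiniteModConst K,
       EnergyKernel.IsUniqueMinimizer (EnergyKernel.energy K) (EnergyKernel.massOne Ω)
         μ.toSignedMeasure,
       StrictConvexOn ℝ (EnergyKernel.probabilities Ω) (EnergyKernel.energy K),
       StrictConvexOn ℝ (EnergyKernel.massOne Ω) (EnergyKernel.energy K)] ∧
    (μ.support = Set.univ → EnergyKernel.ConditionallyStrictlyPositiveDefinite K →
      -- an orthonormal eigenbasis whose first member is constant exists
      (∃ (lam : EnergyKernel.L2Index μ → ℝ) (e : EnergyKernel.L2Index μ → Lp ℝ 2 μ),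
        EnergyKernel.IsEigenbasis K μ lam e ∧
          ∀ j : EnergyKernel.L2Index μ, j.1 = 0 → ∃ c : ℝ, e j =ᵐ[μ] fun _ => c) ∧
      -- and every such eigenbasis yields the expansion, through continuous representatives
      (∀ (lam : EnergyKernel.L2Index μ → ℝ) (e : EnergyKernel.L2Index μ → Lp ℝ 2 μ),
        EnergyKernel.IsEigenbasis K μ lam e →
        (∀ j : EnergyKernel.L2Index μ, j.1 = 0 → ∃ c : ℝ, e j =ᵐ[μ] fun _ => c) →
        ∃ φ : EnergyKernel.L2Index μ → C(Ω, ℝ),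
          (∀ j, ContinuousMap.toLp 2 μ ℝ (φ j) = e j) ∧
            EnergyKernel.IsStrictMercerExpansion K μ lam φ)) ∧
    (∀ (lam : EnergyKernel.L2Index μ → ℝ) (φ : EnergyKernel.L2Index μ → C(Ω, ℝ)),
      EnergyKernel.IsStrictMercerExpansion K μ lam φ →
      Dense (Submodule.span ℝ (Set.range φ) : Set C(Ω, ℝ)) →
      EnergyKernel.ConditionallyStrictlyPositiveDefinite K) := by
  exact ⟨EnergyKernel.tfae_conditionallyStrictlyPositiveDefinite hK hμ,
    fun hsupp h => ⟨EnergyKernel.exists_isEigenbasis hK hμ,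
      fun _ _ he he0 => EnergyKernel.exists_isStrictMercerExpansion hK hμ hsupp h he he0⟩,
    fun _ _ h hd =>
      EnergyKernel.conditionallyStrictlyPositiveDefinite_of_isStrictMercerExpansion hK h hd⟩
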